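/- Let $s\ge 1$ be an integer, let $q=p^e$ be a power of a prime $p$, and let $\mathbb F_q$ be the field with $q$ elements. Let $C^{(i)}=(c^{(i)}_{j,r})_{j\ge 1,\,r\ge 0}$, $1\le i\le s$, be infinite matrices over $\mathbb F_q$ such that each row has only finitely many nonzero entries. Let ${\bf T}:\mathbb N_0\to\mathbb N_0$ be such that for every $m$ with $m>{\bf T}(m)$ and all integers $d_1,\dots,d_s\ge 0$ with $1\le d_1+\cdots+d_s\le m-{\bf T}(m)$, the matrix formed by the row vectors $(c^{(i)}_{j,0},\dots,c^{(i)}_{j,m-1})\in\mathbb F_q^m$ with $1\le j\le d_i$ and $1\le i\le s$ has rank $d_1+\cdots+d_s$. Let $\psi_r:\{0,\dots,q-1\}\to\mathbb F_q$ ($r\ge 0$) and $\lambda_{i,j}:\mathbb F_q\to\{0,\dots,q-1\}$ ($1\le i\le s$, $j\ge 1$) be arbitrary bijections, and let $\alpha$ be a $q$-adic integer (equivalently, a $p$-adic integer). For $n\ge 0$ write $n+\alpha=\sum_{r\ge 0}a_r(n)\,q^r$ with digits $a_r(n)\in\{0,\dots,q-1\}$, and let $\boldsymbol x_n\in[0,1]^s$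 be the point with coordinates $$\boldsymbol x_n^{(i)}=\sum_{j=1}^\infty \lambda_{i,j}\Bigl(\sum_{r=0}^\infty c^{(i)}_{j,r}\,\psi_r(a_r(n))\Bigr)q^{-j},\qquad 1\le i\le s.$$ For $N\ge 1$ let $$D_N^*=\sup_J\left|\frac{\#\{0\le n<N:\boldsymbol x_n\in J\}}{N}-\mathrm{vol}(J)\right|$$ be the star discrepancy of the first $N$ points, where $J$ runs through all products $J_1\times\cdots\times J_s$ in which each $J_i$ is $[0,u_i)$ or $[0,u_i]$ with $0\le u_i\le 1$. If there is $t\in\mathbb N_0$ with ${\bf T}(m)\le t$ for all $m\ge 0$, then $(\boldsymbol x_n)_{n\ge 0}$ is a low-discrepancy sequence: there are $c>0$ and $K\in\mathbb R$, independent of $N$, such that $N D_N^*\le c(\log N)^s+K(\log N)^{s-1}$ for all $N\ge 2$. In particular, $N D_N^*=O((\log N)^s)$ as $N\to\infty$. -/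

import Mathlib

open Filter Asymptotics

noncomputable section

/-- The base-`q` digit with index `r` of the `q`-adic integer `x`, where `q = p ^ e` is a power of
the prime `p`. The pseudo-valuation that defines the `q`-adic integers is, for `q = p ^ e`, the
usual `p`-adic absolute value, so the ring of `q`-adic integers is `ℤ_[p]`.
Here `PadicInt.appr x k` is the natural number below `p ^ k` that is congruent to `x` modulo
`p ^ k`; the digits are characterised by `hasSum_qadicDigit` below. -/
def qadicDigit {p : ℕ} [Fact p.Prime] (e : ℕ) (x : ℤ_[p]) (r : ℕ) : Fin (p ^ e) :=
  ⟨PadicInt.appr x (e * (r + 1)) / (p ^ e) ^ r % p ^ e,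
    Nat.mod_lt _ (pow_pos (Fact.out : p.Prime).pos e)⟩

theorem sum_qadicDigit {p : ℕ} [Fact p.Prime] (e : ℕ) (x : ℤ_[p]) (k : ℕ) :
    ∑ r ∈ Finset.range k, (qadicDigit e x r : ℕ) * (p ^ e) ^ r = PadicInt.appr x (e * k) := by
  induction k with
  | zero => simp [PadicInt.appr]
  | succ k ih =>
    have hlt : PadicInt.appr x (e * k) < (p ^ e) ^ k := by
      rw [← pow_mul]; exact PadicInt.appr_lt x _
    have hlt' : PadicInt.appr x (e * (k + 1)) < (p ^ e) ^ k * p ^ e := by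
      rw [← pow_succ, ← pow_mul]; exact PadicInt.appr_lt x _
    have hmono : e * k ≤ e * (k + 1) := Nat.mul_le_mul_left e (Nat.le_succ k)
    have hmod : PadicInt.appr x (e * (k + 1)) % (p ^ e) ^ k = PadicInt.appr x (e * k) := by
      have h := PadicInt.dvd_appr_sub_appr x (e * k) (e * (k + 1)) hmono
      rw [pow_mul] at h
      have h2 := (Nat.modEq_iff_dvd' (PadicInt.appr_mono x hmono)).2 h
      have h3 : PadicInt.appr x (e * k) % (p ^ e) ^ k =
        PadicInt.appr x (e * (k + 1)) % (p ^ e) ^ k := h2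
      rw [← h3, Nat.mod_eq_of_lt hlt]
    rw [Finset.sum_range_succ, ih]
    have hdig : (qadicDigit e x k : ℕ) = PadicInt.appr x (e * (k + 1)) / (p ^ e) ^ k :=
      Nat.mod_eq_of_lt (Nat.div_lt_of_lt_mul hlt')
    rw [hdig, ← hmod]
    exact Nat.mod_add_div' _ _

/-- The digits do represent `x`: `x = ∑ r, a_r q ^ r` in the `q`-adic integers. -/
theorem hasSum_qadicDigit {p : ℕ} [Fact p.Prime] {e : ℕ} (he : e ≠ 0) (x : ℤ_[p]) :
    HasSum (fun r => ((qadicDigit e x r : ℕ) : ℤ_[p]) * ((p : ℤ_[p]) ^ e) ^ r) x := by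
  have hp : (1 : ℝ) < p := by exact_mod_cast (Fact.out : p.Prime).one_lt
  have hp0 : (0 : ℝ) < p := by linarith
  have hq1 : ((p : ℝ)⁻¹) ^ e < 1 := pow_lt_one₀ (by positivity) (inv_lt_one_of_one_lt₀ hp) he
  have hsum : Summable (fun r => ((qadicDigit e x r : ℕ) : ℤ_[p]) * ((p : ℤ_[p]) ^ e) ^ r) := by
    refine Summable.of_norm_bounded
      (summable_geometric_of_lt_one (by positivity : (0 : ℝ) ≤ ((p : ℝ)⁻¹) ^ e) hq1) ?_
    intro r
    rw [norm_mul, norm_pow, norm_pow, PadicInt.norm_p]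
    exact mul_le_of_le_one_left (by positivity) (PadicInt.norm_le_one _)
  refine (hsum.hasSum_iff_tendsto_nat).2 ?_
  rw [tendsto_iff_norm_sub_tendsto_zero]
  refine squeeze_zero (fun _ => norm_nonneg _) (fun k => ?_)
    (tendsto_pow_atTop_nhds_zero_of_lt_one (by positivity : (0 : ℝ) ≤ ((p : ℝ)⁻¹) ^ e) hq1)
  have h1 : ∑ r ∈ Finset.range k, ((qadicDigit e x r : ℕ) : ℤ_[p]) * ((p : ℤ_[p]) ^ e) ^ r
      = (PadicInt.appr x (e * k) : ℤ_[p]) := by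
    rw [← sum_qadicDigit]; push_cast; rfl
  rw [h1, norm_sub_rev]
  have h2 := (PadicInt.norm_le_pow_iff_mem_span_pow _ _).2 (PadicInt.appr_spec (e * k) x)
  refine h2.trans (le_of_eq ?_)
  rw [zpow_neg, zpow_natCast, ← pow_mul, inv_pow]

/-- The point of `[0,1]^s` that the digital method in base `b` over the ring `R` assigns to the
digit sequence `a_0, a_1, …`; its `i`-th coordinate is
`∑_{j ≥ 1} λ_{i,j} (∑_{r ≥ 0} c^{(i)}_{j,r} ψ_r (a_r)) / b ^ j`.
Rows are numbered from `0` here: index `j` of `C i` and of `lam i` stands for `j + 1`. The inner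
sum is finite when the matrices have finite rows. -/
def digitalPoint {b s : ℕ} {R : Type*} [CommRing R] (ψ : ℕ → Fin b ≃ R)
    (lam : Fin s → ℕ → R ≃ Fin b) (C : Fin s → Matrix ℕ ℕ R) (a : ℕ → Fin b) : Fin s → ℝ :=
  fun i => ∑' j : ℕ, ((lam i j (∑ᶠ r : ℕ, C i j r * ψ r (a r)) : ℕ) : ℝ) / (b : ℝ) ^ (j + 1)

/-- The digital sequence in base `q = p ^ e` whose index sequence `S` consists of `q`-adic
integers: its `n`-th point is built from the `q`-adic digits of `S n`. -/
def digitalSequence {p e s : ℕ} [Fact p.Prime] {R : Type*} [CommRing R]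
    (ψ : ℕ → Fin (p ^ e) ≃ R) (lam : Fin s → ℕ → R ≃ Fin (p ^ e)) (C : Fin s → Matrix ℕ ℕ R)
    (S : ℕ → ℤ_[p]) : ℕ → Fin s → ℝ :=
  fun n => digitalPoint ψ lam C (qadicDigit e (S n))

/-- Every row of every matrix has only finitely many nonzero entries. -/
def FiniteRow {s : ℕ} {R : Type*} [CommRing R] (C : Fin s → Matrix ℕ ℕ R) : Prop :=
  ∀ i j, ∃ L : ℕ, ∀ r, L ≤ r → C i j r = 0

/-- The matrices `C` have the quality-parameter function `T`: for all `m > T m` and all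
`d_1, …, d_s ≥ 0` with `1 ≤ d_1 + ⋯ + d_s ≤ m - T m`, the matrix formed by the first `m` entries
of the first `d_i` rows of the `i`-th matrix, `1 ≤ i ≤ s`, has rank `d_1 + ⋯ + d_s`. -/
def HasQuality {s : ℕ} {F : Type*} [Field F] (C : Fin s → Matrix ℕ ℕ F) (T : ℕ → ℕ) : Prop :=
  ∀ m, T m < m → ∀ d : Fin s → ℕ, 1 ≤ ∑ i, d i → ∑ i, d i ≤ m - T m →
    (Matrix.of fun (k : Σ i : Fin s, Fin (d i)) (r : Fin m) => C k.1 k.2 r).rank = ∑ i, d i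

/-- The star discrepancy of the first `N` points of `x`: the supremum of `|A(J) / N - vol J|` over
the subintervals `J` of `[0,1]^s` with one vertex at the origin, that is, over the products of
intervals `[0, u_i)` or `[0, u_i]` with `0 ≤ u_i ≤ 1`. -/
def starDiscrepancy {s : ℕ} (x : ℕ → Fin s → ℝ) (N : ℕ) : ℝ :=
  sSup {δ : ℝ | ∃ (u : Fin s → ℝ) (J : Fin s → Set ℝ),
    (∀ i, u i ∈ Set.Icc (0 : ℝ) 1) ∧
    (∀ i, J i = Set.Ico 0 (u i) ∨ J i = Set.Icc 0 (u i)) ∧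
    δ = |(Set.ncard {n : ℕ | n < N ∧ ∀ i, x n i ∈ J i} : ℝ) / N - ∏ i, u i|}

/-- `x` is a low-discrepancy sequence in dimension `s`:
`N D*_N ≤ c (log N)^s + O((log N)^(s-1))` for all `N ≥ 2`, with `c > 0` and an implied constant
that do not depend on `N`. -/
def IsLowDiscrepancy {s : ℕ} (x : ℕ → Fin s → ℝ) : Prop :=
  ∃ c : ℝ, 0 < c ∧ ∃ K : ℝ, ∀ N : ℕ, 2 ≤ N →
    N * starDiscrepancy x N ≤ c * Real.log N ^ s + K * Real.log N ^ (s - 1)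

end

/-!
# Digital sequences indexed by `n + α` with bounded quality parameter have low discrepancy

Write `q = p ^ e`. An elementary interval prescribes the first `d i` base-`q` digits of each
coordinate `i`; let `d = ∑ i, d i` and `m = d + t`. The `q`-adic integers `n + α` split into blocks
`{l + q ^ m γ : 0 ≤ l < q ^ m}`. Inside a block the upper digits are constant, so prescribing the
output digits is an inhomogeneous linear system for the `m` lower digits of `l`; since `T m ≤ t`,
its matrix has full row rank `d`, and there are exactly `q ^ (m - d) = q ^ t` solutions
(`card_block_outputDigit`). As `0 ≤ n < N` is a difference of two initial segments of the sequence
of blocks, every elementary interval has counting error at most `2 q ^ t`, uniformly in its order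
(`abs_card_elementary_sub_le`).

An initial segment on the grid of mesh `q ^ (-k)` is a disjoint union of at most `1 + k q`
elementary intervals (`exists_elementary_decomposition`), so a box at the origin with corners on
this grid splits into at most `(1 + k q) ^ s` of them. An arbitrary box is squeezed between two such
grid boxes whose volumes differ by at most `2 s q ^ (-k)` (`mul_starDiscrepancy_le`). With
`k = ⌊log_q N⌋ + 1` the total error is `O((log N) ^ s)`.

Everything is phrased in terms of the digits of the points, not of their real values. A point whose
digits are eventually all `q - 1` has a second expansion, and it may lie on the boundary of the
elementary interval that its digits determine; only the weak inequalities between a digit prefix and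
the real value are used, and the two grid boxes leave room for such points.
-/

/-! ### Digit prefixes and elementary intervals -/

/-- The integer whose base-`b` expansion is formed by the first `k` digits of `y`, so that
`digitPrefix y k / b ^ k` is the truncation of `0.y₀y₁…` after `k` digits. -/
def digitPrefix {b : ℕ} (y : ℕ → Fin b) : ℕ → ℕ
  | 0 => 0
  | k + 1 => b * digitPrefix y k + y k

theorem digitPrefix_lt {b : ℕ} (y : ℕ → Fin b) (k : ℕ) : digitPrefix y k < b ^ k := by
  induction k with
  | zero => simp [digitPrefix]
  | succ k ih =>
    have h := (y k).isLt
    calc b * digitPrefix y k + y k < b * digitPrefix y k + b := by omega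
      _ = b * (digitPrefix y k + 1) := by ring
      _ ≤ b * b ^ k := Nat.mul_le_mul_left _ ih
      _ = b ^ (k + 1) := by ring

theorem digitPrefix_eq_sum {b : ℕ} (y : ℕ → Fin b) (k : ℕ) :
    (digitPrefix y k : ℝ) = b ^ k * ∑ i ∈ Finset.range k, Real.ofDigitsTerm y i := by
  have hb : (b : ℝ) ≠ 0 := by exact_mod_cast (Fin.pos (y 0)).ne'
  induction k with
  | zero => simp [digitPrefix]
  | succ k ih =>
    rw [digitPrefix, Finset.sum_range_succ, Nat.cast_add, Nat.cast_mul, ih, Real.ofDigitsTerm]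
    field_simp
    ring

theorem digitPrefix_le_ofDigits {b : ℕ} (y : ℕ → Fin b) (k : ℕ) :
    (digitPrefix y k : ℝ) ≤ b ^ k * Real.ofDigits y := by
  have hb : (0 : ℝ) < b := by exact_mod_cast Fin.pos (y 0)
  rw [digitPrefix_eq_sum, Real.ofDigits_eq_sum_add_ofDigits y k]
  gcongr
  have := Real.ofDigits_nonneg (fun i => y (i + k))
  have : 0 ≤ ((b : ℝ) ^ k)⁻¹ * Real.ofDigits (fun i => y (i + k)) := by positivity
  linarith

theorem ofDigits_le_digitPrefix_add_one {b : ℕ} (y : ℕ → Fin b) (k : ℕ) :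
    b ^ k * Real.ofDigits y ≤ (digitPrefix y k : ℝ) + 1 := by
  have hb : (b : ℝ) ≠ 0 := by exact_mod_cast (Fin.pos (y 0)).ne'
  rw [digitPrefix_eq_sum, Real.ofDigits_eq_sum_add_ofDigits y k, mul_add,
    mul_inv_cancel_left₀ (pow_ne_zero k hb)]
  linarith [Real.ofDigits_le_one (fun i => y (i + k))]

/-- Prescribing the value of a digit prefix is the same as prescribing each of its digits. -/
theorem exists_digitPrefix_eq_iff {b : ℕ} (hb : 0 < b) {k c : ℕ} (hc : c < b ^ k) :
    ∃ g : ℕ → Fin b, ∀ y : ℕ → Fin b, digitPrefix y k = c ↔ ∀ j < k, y j = g j := by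
  induction k generalizing c with
  | zero => exact ⟨fun _ => ⟨0, hb⟩, fun y => by simp_all [digitPrefix]⟩
  | succ k ih =>
    obtain ⟨g, hg⟩ := ih (c := c / b) (Nat.div_lt_of_lt_mul (by rwa [← pow_succ']))
    refine ⟨Function.update g k ⟨c % b, Nat.mod_lt _ hb⟩, fun y => ?_⟩
    have h1 : digitPrefix y (k + 1) = c ↔ digitPrefix y k = c / b ∧ (y k : ℕ) = c % b := by
      rw [digitPrefix, eq_comm (b := c / b), eq_comm (b := c % b),
        Nat.div_mod_unique hb]
      have := (y k).isLt
      constructor <;> intro h <;> omega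
    rw [h1, hg, Nat.forall_lt_succ_right]
    refine and_congr (forall₂_congr fun j hj => ?_) ?_
    · rw [Function.update_of_ne hj.ne]
    · rw [Function.update_self, Fin.ext_iff]

/-- The initial segment of all expansions whose `k`-digit prefix is below `U` splits into at most
`1 + k * b` elementary intervals; an element `(j, c)` of the finset stands for the interval of
order `j` with prefix `c`. -/
theorem exists_elementary_decomposition {b : ℕ} (hb : 0 < b) (k : ℕ) {U : ℕ} (hU : U ≤ b ^ k) :
    ∃ S : Finset (ℕ × ℕ), S.card ≤ 1 + k * b ∧ (∀ e ∈ S, e.1 ≤ k ∧ e.2 < b ^ e.1) ∧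
      (∀ y : ℕ → Fin b, (if digitPrefix y k < U then (1 : ℝ) else 0) =
        ∑ e ∈ S, if digitPrefix y e.1 = e.2 then (1 : ℝ) else 0) ∧
      (U : ℝ) / b ^ k = ∑ e ∈ S, 1 / (b : ℝ) ^ e.1 := by
  induction k generalizing U with
  | zero =>
    have hU' : U = 0 ∨ U = 1 := by simp at hU; omega
    rcases hU' with rfl | rfl
    · exact ⟨∅, by simp [digitPrefix]⟩
    · exact ⟨{(0, 0)}, by simp, by simp, fun y => by rw [Finset.sum_singleton]; simp [digitPrefix],
        by simp⟩
  | succ k ih =>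
    obtain ⟨S, hcard, hS, hind, hvol⟩ :=
      ih (U := U / b) (Nat.div_le_of_le_mul (by rwa [← pow_succ']))
    -- A `k + 1`-digit prefix below `U` either has its `k`-digit prefix below `U / b`, or extends
    -- `U / b` by a last digit below `U % b`; the finset `R` collects the intervals of the second kind.
    have hbU : b * (U / b) + U % b = U := Nat.div_add_mod U b
    have hmod : U % b < b := Nat.mod_lt _ hb
    set R : Finset (ℕ × ℕ) :=
      (Finset.range (U % b)).image fun r => (k + 1, b * (U / b) + r) with hR
    have hinj : Set.InjOn (fun r => (k + 1, b * (U / b) + r)) (Finset.range (U % b) : Set ℕ) := by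
      intro r _ r' _ h
      simpa using h
    have hdisj : Disjoint S R := by
      rw [Finset.disjoint_left]
      intro e he he'
      obtain ⟨r, _, rfl⟩ := Finset.mem_image.1 he'
      have := (hS _ he).1
      simp at this
    refine ⟨S ∪ R, ?_, ?_, fun y => ?_, ?_⟩
    · have : R.card ≤ U % b := Finset.card_image_le.trans (by simp)
      calc (S ∪ R).card ≤ S.card + R.card := Finset.card_union_le _ _
        _ ≤ (1 + k * b) + b := by omega
        _ = 1 + (k + 1) * b := by ring
    · intro e he
      rcases Finset.mem_union.1 he with he | he
      · exact ⟨(hS e he).1.trans (Nat.le_succ k), (hS e he).2⟩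
      · obtain ⟨r, hr, rfl⟩ := Finset.mem_image.1 he
        have := Finset.mem_range.1 hr
        refine ⟨le_rfl, ?_⟩
        dsimp only
        omega
    · rw [Finset.sum_union hdisj, ← hind, hR, Finset.sum_image hinj]
      dsimp only
      have hy := (y k).isLt
      have hpre : digitPrefix y (k + 1) = b * digitPrefix y k + y k := rfl
      simp only [hpre]
      rcases lt_trichotomy (digitPrefix y k) (U / b) with h | h | h
      · have h2 : b * (digitPrefix y k + 1) ≤ b * (U / b) := Nat.mul_le_mul_left _ h
        rw [mul_add] at h2
        rw [if_pos (by omega), if_pos h, Finset.sum_eq_zero]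
        · simp
        · intro r _
          rw [if_neg (by omega)]
      · rw [h, if_neg (lt_irrefl _), zero_add]
        simp only [add_right_inj]
        rw [Finset.sum_ite_eq]
        simp only [Finset.mem_range]
        congr 1
        rw [eq_iff_iff]
        omega
      · have h2 : b * (U / b + 1) ≤ b * digitPrefix y k := Nat.mul_le_mul_left _ h
        rw [mul_add] at h2
        rw [if_neg (by omega), if_neg (by omega), Finset.sum_eq_zero]
        · simp
        · intro r hr
          have := Finset.mem_range.1 hr
          rw [if_neg (by omega)]
    · have hb' : (b : ℝ) ≠ 0 := by exact_mod_cast hb.ne'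
      rw [Finset.sum_union hdisj, ← hvol, hR, Finset.sum_image hinj]
      simp only [Finset.sum_const, Finset.card_range, nsmul_eq_mul]
      have : (U : ℝ) = b * (U / b : ℕ) + (U % b : ℕ) := by exact_mod_cast hbU.symm
      rw [this]
      field_simp
      ring

/-! ### From elementary intervals to boxes -/

/-- If every elementary interval has counting error at most `B`, then a box at the origin with
corners on the grid of mesh `b ^ (-k)` has counting error at most `B * (1 + k * b) ^ s`. -/
theorem abs_card_prefix_lt_sub_le {b s N : ℕ} (hb : 0 < b) {y : ℕ → Fin s → ℕ → Fin b} {B : ℝ}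
    (hB : 0 ≤ B)
    (hE : ∀ d c : Fin s → ℕ, (∀ i, c i < b ^ d i) →
      |(((Finset.range N).filter fun n => ∀ i, digitPrefix (y n i) (d i) = c i).card : ℝ) -
        N * ∏ i, 1 / (b : ℝ) ^ d i| ≤ B)
    (k : ℕ) (U : Fin s → ℕ) (hU : ∀ i, U i ≤ b ^ k) :
    |(((Finset.range N).filter fun n => ∀ i, digitPrefix (y n i) k < U i).card : ℝ) -
      N * ∏ i, (U i : ℝ) / b ^ k| ≤ B * (1 + k * b) ^ s := by
  classical
  choose S hcard hS hind hvol using fun i => exists_elementary_decomposition hb k (hU i)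
  have hprod : ∀ (P : Fin s → Prop) [DecidablePred P] [Decidable (∀ i, P i)],
      (if ∀ i, P i then (1 : ℝ) else 0) = ∏ i, if P i then 1 else 0 := by
    intro P _ _
    rw [Finset.prod_boole]
    simp
  have h1 : (((Finset.range N).filter fun n => ∀ i, digitPrefix (y n i) k < U i).card : ℝ) =
      ∑ f ∈ Fintype.piFinset S, (((Finset.range N).filter fun n =>
        ∀ i, digitPrefix (y n i) (f i).1 = (f i).2).card : ℝ) := by
    simp_rw [Finset.card_filter, Nat.cast_sum, Nat.cast_ite, Nat.cast_one, Nat.cast_zero]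
    rw [Finset.sum_comm]
    refine Finset.sum_congr rfl fun n _ => ?_
    simp_rw [hprod, hind]
    exact Finset.prod_univ_sum S fun i e => if digitPrefix (y n i) e.1 = e.2 then (1 : ℝ) else 0
  have h2 : (N : ℝ) * ∏ i, (U i : ℝ) / b ^ k =
      ∑ f ∈ Fintype.piFinset S, N * ∏ i, 1 / (b : ℝ) ^ (f i).1 := by
    simp_rw [hvol, ← Finset.mul_sum]
    rw [Finset.prod_univ_sum S fun _ e => 1 / (b : ℝ) ^ e.1]
  rw [h1, h2, ← Finset.sum_sub_distrib]
  have hN : ((Fintype.piFinset S).card : ℝ) ≤ (1 + k * b) ^ s := by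
    rw [Fintype.card_piFinset, Nat.cast_prod]
    calc ∏ i, ((S i).card : ℝ) ≤ ∏ _i : Fin s, (1 + k * b : ℝ) :=
          Finset.prod_le_prod (fun _ _ => by positivity) fun i _ => by exact_mod_cast hcard i
      _ = (1 + k * b) ^ s := by simp
  calc _ ≤ ∑ f ∈ Fintype.piFinset S, B := by
        refine (Finset.abs_sum_le_sum_abs _ _).trans (Finset.sum_le_sum fun f hf => ?_)
        exact hE (fun i => (f i).1) (fun i => (f i).2)
          fun i => (hS i _ (Fintype.mem_piFinset.1 hf i)).2
    _ = (Fintype.piFinset S).card * B := by simp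
    _ ≤ (1 + k * b) ^ s * B := by gcongr
    _ = _ := mul_comm _ _

/-- Increasing each factor in `[0, 1]` by at most `δ` increases the product by at most `δ` per
factor. -/
theorem prod_le_prod_add_card_mul {ι : Type*} (A : Finset ι) {v w : ι → ℝ} {δ : ℝ}
    (hv : ∀ i, 0 ≤ v i) (hvw : ∀ i, v i ≤ w i) (hw : ∀ i, w i ≤ 1) (hδ : ∀ i, w i ≤ v i + δ) :
    ∏ i ∈ A, w i ≤ ∏ i ∈ A, v i + A.card * δ := by
  classical
  induction A using Finset.induction_on with
  | empty => simp
  | insert a A ha ih =>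
    rw [Finset.prod_insert ha, Finset.prod_insert ha, Finset.card_insert_of_notMem ha]
    have hW : ∏ i ∈ A, w i ≤ 1 :=
      Finset.prod_le_one (fun i _ => (hv i).trans (hvw i)) fun i _ => hw i
    have hW0 : 0 ≤ ∏ i ∈ A, w i := Finset.prod_nonneg fun i _ => (hv i).trans (hvw i)
    have hδ0 : 0 ≤ δ := by linarith [hvw a, hδ a]
    have hv1 : v a ≤ 1 := (hvw a).trans (hw a)
    calc w a * ∏ i ∈ A, w i ≤ (v a + δ) * ∏ i ∈ A, w i := by gcongr; exact hδ a
      _ = v a * ∏ i ∈ A, w i + δ * ∏ i ∈ A, w i := by ring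
      _ ≤ v a * (∏ i ∈ A, v i + A.card * δ) + δ * 1 := by
          gcongr
          exact hv a
      _ = v a * ∏ i ∈ A, v i + v a * (A.card * δ) + δ := by ring
      _ ≤ v a * ∏ i ∈ A, v i + 1 * (A.card * δ) + δ := by gcongr
      _ = _ := by push_cast; ring

theorem starDiscrepancy_nonneg {s : ℕ} (x : ℕ → Fin s → ℝ) (N : ℕ) : 0 ≤ starDiscrepancy x N := by
  refine Real.sSup_nonneg ?_
  rintro δ ⟨u, J, -, -, rfl⟩
  exact abs_nonneg _

/-- A uniform bound on the counting error of elementary intervals bounds the star discrepancy: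
every box is squeezed between two boxes with corners on the grid of mesh `b ^ (-k)`. -/
theorem mul_starDiscrepancy_le {b s N : ℕ} (hb : 0 < b) (hN : 0 < N)
    {y : ℕ → Fin s → ℕ → Fin b} {B : ℝ} (hB : 0 ≤ B)
    (hE : ∀ d c : Fin s → ℕ, (∀ i, c i < b ^ d i) →
      |(((Finset.range N).filter fun n => ∀ i, digitPrefix (y n i) (d i) = c i).card : ℝ) -
        N * ∏ i, 1 / (b : ℝ) ^ d i| ≤ B) (k : ℕ) :
    N * starDiscrepancy (fun n i => Real.ofDigits (y n i)) N ≤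
      B * (1 + k * b) ^ s + 2 * s * (N / b ^ k) := by
  classical
  have hN' : (0 : ℝ) < N := by exact_mod_cast hN
  have hbk : (0 : ℝ) < (b : ℝ) ^ k := by positivity
  rw [← le_div_iff₀' hN']
  refine Real.sSup_le ?_ (by positivity)
  rintro δ ⟨u, J, hu, hJ, rfl⟩
  rw [le_div_iff₀' hN']
  set A : Finset ℕ := (Finset.range N).filter fun n => ∀ i, Real.ofDigits (y n i) ∈ J i with hA
  have hAcard : {n : ℕ | n < N ∧ ∀ i, Real.ofDigits (y n i) ∈ J i}.ncard = A.card := by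
    rw [← Set.ncard_coe_finset]
    congr 1
    ext n
    simp [hA]
  rw [hAcard]
  set U : Fin s → ℕ := fun i => ⌊u i * b ^ k⌋₊ with hUdef
  have hu0 : ∀ i, 0 ≤ u i * b ^ k := fun i => mul_nonneg (hu i).1 hbk.le
  have hUle : ∀ i, (U i : ℝ) ≤ u i * b ^ k := fun i => Nat.floor_le (hu0 i)
  have hUlt : ∀ i, u i * b ^ k < U i + 1 := fun i => Nat.lt_floor_add_one _
  have hUb : ∀ i, U i ≤ b ^ k := fun i => by
    have : (U i : ℝ) ≤ (b : ℝ) ^ k := (hUle i).trans (mul_le_of_le_one_left hbk.le (hu i).2)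
    exact_mod_cast this
  -- The inner box has corners `U i - 1`, not `U i`: when `u i * b ^ k = U i`, a point with prefix
  -- `U i - 1` may have the value `u i`, which a half-open box excludes. The truncated subtraction
  -- at `U i = 0` yields the empty box.
  have hlo := abs_card_prefix_lt_sub_le hb hB hE k (fun i => U i - 1)
    fun i => (Nat.sub_le _ _).trans (hUb i)
  have hhi := abs_card_prefix_lt_sub_le hb hB hE k (fun i => min (U i + 1) (b ^ k))
    fun i => min_le_right _ _
  have hsub1 : ((Finset.range N).filter fun n => ∀ i, digitPrefix (y n i) k < U i - 1) ⊆ A := by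
    intro n hn
    rw [Finset.mem_filter] at hn
    refine Finset.mem_filter.2 ⟨hn.1, fun i => ?_⟩
    have h1 : digitPrefix (y n i) k + 2 ≤ U i := by have := hn.2 i; omega
    have h2 : (digitPrefix (y n i) k : ℝ) + 2 ≤ U i := by exact_mod_cast h1
    have h3 := ofDigits_le_digitPrefix_add_one (y n i) k
    have h4 : Real.ofDigits (y n i) < u i := by
      refine lt_of_mul_lt_mul_left (a := (b : ℝ) ^ k) ?_ hbk.le
      linarith [hUle i]
    rcases hJ i with h | h <;> rw [h]
    · exact ⟨Real.ofDigits_nonneg _, h4⟩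
    · exact ⟨Real.ofDigits_nonneg _, h4.le⟩
  have hsub2 : A ⊆ (Finset.range N).filter fun n =>
      ∀ i, digitPrefix (y n i) k < min (U i + 1) (b ^ k) := by
    intro n hn
    rw [hA, Finset.mem_filter] at hn
    refine Finset.mem_filter.2 ⟨hn.1, fun i => lt_min ?_ (digitPrefix_lt _ _)⟩
    have h1 : Real.ofDigits (y n i) ≤ u i := by
      have := hn.2 i
      rcases hJ i with h | h <;> rw [h] at this
      · exact this.2.le
      · exact this.2
    refine Nat.lt_succ_of_le (Nat.le_floor ((digitPrefix_le_ofDigits _ _).trans ?_))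
    rw [mul_comm]
    gcongr
  have hc1 : (((Finset.range N).filter fun n => ∀ i, digitPrefix (y n i) k < U i - 1).card : ℝ) ≤
      A.card := by exact_mod_cast Finset.card_le_card hsub1
  have hc2 : (A.card : ℝ) ≤ ((Finset.range N).filter fun n =>
      ∀ i, digitPrefix (y n i) k < min (U i + 1) (b ^ k)).card := by
    exact_mod_cast Finset.card_le_card hsub2
  have hm1 : ∀ i, ((U i - 1 : ℕ) : ℝ) ≤ U i := fun i => by exact_mod_cast Nat.sub_le _ _
  have hm2 : ∀ i, (U i : ℝ) ≤ ((U i - 1 : ℕ) : ℝ) + 1 := fun i => by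
    have : U i ≤ U i - 1 + 1 := by omega
    exact_mod_cast this
  have hv0 : ∀ i, (0 : ℝ) ≤ ((U i - 1 : ℕ) : ℝ) / b ^ k := fun i => by positivity
  have hvu : ∀ i, ((U i - 1 : ℕ) : ℝ) / b ^ k ≤ u i := fun i => by
    rw [div_le_iff₀ hbk]; linarith [hm1 i, hUle i]
  have huw : ∀ i, u i ≤ ((min (U i + 1) (b ^ k) : ℕ) : ℝ) / b ^ k := fun i => by
    rw [le_div_iff₀ hbk, Nat.cast_min]
    refine le_min ?_ ?_
    · push_cast; exact (hUlt i).le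
    · push_cast; exact mul_le_of_le_one_left hbk.le (hu i).2
  have hw1 : ∀ i, ((min (U i + 1) (b ^ k) : ℕ) : ℝ) / b ^ k ≤ 1 := fun i => by
    rw [div_le_one hbk]
    exact_mod_cast min_le_right _ _
  have hwv : ∀ i, ((min (U i + 1) (b ^ k) : ℕ) : ℝ) / b ^ k ≤
      ((U i - 1 : ℕ) : ℝ) / b ^ k + 2 / b ^ k := fun i => by
    rw [← add_div]
    gcongr
    have h : ((min (U i + 1) (b ^ k) : ℕ) : ℝ) ≤ ((U i + 1 : ℕ) : ℝ) := by
      exact_mod_cast min_le_left _ _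
    push_cast at h ⊢
    linarith [hm2 i]
  have hp1 : ∏ i, ((U i - 1 : ℕ) : ℝ) / b ^ k ≤ ∏ i, u i :=
    Finset.prod_le_prod (fun i _ => hv0 i) fun i _ => hvu i
  have hp2 : ∏ i, u i ≤ ∏ i, ((min (U i + 1) (b ^ k) : ℕ) : ℝ) / b ^ k :=
    Finset.prod_le_prod (fun i _ => (hu i).1) fun i _ => huw i
  have hp3 := prod_le_prod_add_card_mul Finset.univ hv0 (fun i => (hvu i).trans (huw i)) hw1 hwv
  rw [Finset.card_univ, Fintype.card_fin] at hp3
  have hp1' := mul_le_mul_of_nonneg_left hp1 hN'.le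
  have hp2' := mul_le_mul_of_nonneg_left hp2 hN'.le
  have hp3' := mul_le_mul_of_nonneg_left hp3 hN'.le
  have hring : (N : ℝ) * (s * (2 / b ^ k)) = 2 * s * (N / b ^ k) := by ring
  rw [mul_add, hring] at hp3'
  rw [← abs_of_pos hN', ← abs_mul, abs_of_pos hN', mul_sub, mul_div_cancel₀ _ hN'.ne', abs_le]
  rw [abs_le] at hlo hhi
  constructor
  · linarith [hlo.1]
  · linarith [hhi.2]

/-! ### Digits of `q`-adic integers -/

theorem PadicInt.val_toZModPow {p : ℕ} [Fact p.Prime] (x : ℤ_[p]) (k : ℕ) :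
    (PadicInt.toZModPow k x).val = PadicInt.appr x k := by
  change (PadicInt.appr x k : ZMod (p ^ k)).val = _
  rw [ZMod.val_natCast, Nat.mod_eq_of_lt (PadicInt.appr_lt x k)]

theorem PadicInt.appr_natCast_add_pow_mul {p : ℕ} [Fact p.Prime] (l : ℕ) (γ : ℤ_[p]) {k m : ℕ}
    (hkm : k ≤ m) : PadicInt.appr ((l : ℤ_[p]) + (p : ℤ_[p]) ^ m * γ) k = l % p ^ k := by
  have h : ((p : ZMod (p ^ k)) ^ m) = 0 := by
    rw [← Nat.cast_pow, ZMod.natCast_eq_zero_iff]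
    exact pow_dvd_pow p hkm
  rw [← PadicInt.val_toZModPow, map_add, map_mul, map_pow, map_natCast, map_natCast, h, zero_mul,
    add_zero, ZMod.val_natCast]

theorem PadicInt.appr_natCast_add_pow_mul_of_lt {p : ℕ} [Fact p.Prime] {l m : ℕ} (hl : l < p ^ m)
    (γ : ℤ_[p]) (k : ℕ) :
    PadicInt.appr ((l : ℤ_[p]) + (p : ℤ_[p]) ^ m * γ) (m + k) =
      l + p ^ m * PadicInt.appr γ k := by
  have hlt : l + p ^ m * PadicInt.appr γ k < p ^ (m + k) := by
    calc l + p ^ m * PadicInt.appr γ k < p ^ m + p ^ m * PadicInt.appr γ k := by omega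
      _ = p ^ m * (PadicInt.appr γ k + 1) := by ring
      _ ≤ p ^ m * p ^ k := Nat.mul_le_mul_left _ (PadicInt.appr_lt γ k)
      _ = p ^ (m + k) := (pow_add p m k).symm
  obtain ⟨c, hc⟩ := Ideal.mem_span_singleton.1 (PadicInt.appr_spec k γ)
  have hx : (l : ℤ_[p]) + (p : ℤ_[p]) ^ m * γ =
      ((l + p ^ m * PadicInt.appr γ k : ℕ) : ℤ_[p]) + (p : ℤ_[p]) ^ (m + k) * c := by
    push_cast
    linear_combination (p : ℤ_[p]) ^ m * hc
  rw [hx, PadicInt.appr_natCast_add_pow_mul _ _ le_rfl, Nat.mod_eq_of_lt hlt]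

/-- The digits of `l + q ^ m * γ` below the place `m` are those of the natural number `l`. -/
theorem qadicDigit_of_lt {p : ℕ} [Fact p.Prime] (e : ℕ) (l : ℕ) (γ : ℤ_[p]) {m r : ℕ}
    (hr : r < m) :
    (qadicDigit e ((l : ℤ_[p]) + (p : ℤ_[p]) ^ (e * m) * γ) r : ℕ) = l / (p ^ e) ^ r % p ^ e := by
  change PadicInt.appr _ (e * (r + 1)) / (p ^ e) ^ r % p ^ e = _
  rw [PadicInt.appr_natCast_add_pow_mul l γ (Nat.mul_le_mul_left e hr), pow_mul, pow_succ,
    Nat.mod_mul_right_div_self, Nat.mod_mod]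

/-- For `l < q ^ m`, the digits of `l + q ^ m * γ` from the place `m` on are those of `γ`. -/
theorem qadicDigit_of_ge {p : ℕ} [Fact p.Prime] (e : ℕ) {l m r : ℕ} (hl : l < (p ^ e) ^ m)
    (γ : ℤ_[p]) (hr : m ≤ r) :
    qadicDigit e ((l : ℤ_[p]) + (p : ℤ_[p]) ^ (e * m) * γ) r = qadicDigit e γ (r - m) := by
  obtain ⟨r, rfl⟩ := Nat.exists_eq_add_of_le hr
  have hp : 0 < p := (Fact.out : p.Prime).pos
  rw [Nat.add_sub_cancel_left]
  ext
  change PadicInt.appr _ (e * (m + r + 1)) / (p ^ e) ^ (m + r) % p ^ e =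
    PadicInt.appr γ (e * (r + 1)) / (p ^ e) ^ r % p ^ e
  rw [add_assoc, mul_add, PadicInt.appr_natCast_add_pow_mul_of_lt (by rwa [pow_mul]), pow_add,
    ← Nat.div_div_eq_div_mul, pow_mul, Nat.add_mul_div_left _ _ (by positivity),
    Nat.div_eq_of_lt hl, zero_add]

/-! ### Counting solutions of the digit equations -/

/-- A linear system over a finite field with linearly independent rows has the same number of
solutions for every right-hand side. -/
theorem card_mulVec_eq {F : Type*} [Field F] [Fintype F] [DecidableEq F] {ι κ : Type*} [Fintype ι]
    [Fintype κ] [DecidableEq κ] [DecidableEq ι]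
    (M : Matrix ι κ F) (hM : M.rank = Fintype.card ι) (v : ι → F) :
    Fintype.card F ^ Fintype.card ι *
      (Finset.univ.filter fun w : κ → F => M.mulVec w = v).card =
      Fintype.card F ^ Fintype.card κ := by
  have hsurj : Function.Surjective M.mulVecLin := by
    rw [← LinearMap.range_eq_top]
    apply Submodule.eq_top_of_finrank_eq
    rw [Module.finrank_fintype_fun_eq_card, ← hM, Matrix.rank]
  have hfib : ∀ v', (Finset.univ.filter fun w : κ → F => M.mulVec w = v').card =
      (Finset.univ.filter fun w : κ → F => M.mulVec w = v).card := fun v' =>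
    AddMonoidHom.card_fiber_eq_of_mem_range M.mulVecLin.toAddMonoidHom (hsurj v') (hsurj v)
  have h := Finset.card_eq_sum_card_fiberwise (f := fun w : κ → F => M.mulVec w)
    (s := Finset.univ) (t := Finset.univ) (fun _ _ => Finset.mem_coe.2 (Finset.mem_univ _))
  simp only [hfib, Finset.sum_const, Finset.card_univ, Fintype.card_fun, smul_eq_mul] at h
  exact h.symm

/-- The rows of the first `∑ i, d i + t` columns are linearly independent; this includes the empty
system `d = 0`, which `HasQuality` leaves out. -/
theorem HasQuality.rank_eq {s : ℕ} {F : Type*} [Field F] {C : Fin s → Matrix ℕ ℕ F} {T : ℕ → ℕ}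
    (hT : HasQuality C T) {t : ℕ} (hTt : ∀ m, T m ≤ t) (d : Fin s → ℕ) :
    (Matrix.of fun (k : Σ i : Fin s, Fin (d i)) (r : Fin (∑ i, d i + t)) => C k.1 k.2 r).rank =
      ∑ i, d i := by
  rcases Nat.eq_zero_or_pos (∑ i, d i) with h0 | hpos
  · have h := Matrix.rank_le_card_height
      (Matrix.of fun (k : Σ i : Fin s, Fin (d i)) (r : Fin (∑ i, d i + t)) => C k.1 k.2 r)
    rw [Fintype.card_sigma] at h
    simp only [Fintype.card_fin] at h
    omega
  · have := hTt (∑ i, d i + t)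
    exact hT _ (by omega) d hpos (by omega)

theorem finsum_eq_sum_add_finsum_shift {F : Type*} [AddCommMonoid F] {f : ℕ → F} {L : ℕ}
    (hf : ∀ r, L ≤ r → f r = 0) (m : ℕ) :
    ∑ᶠ r, f r = ∑ r : Fin m, f r + ∑ᶠ r, f (m + r) := by
  have h1 : ∑ᶠ r, f r = ∑ r ∈ Finset.range (m + L), f r := by
    refine finsum_eq_sum_of_support_subset _ fun r hr => ?_
    by_contra h
    exact hr (hf r (by simp at h; omega))
  have h2 : ∑ᶠ r, f (m + r) = ∑ r ∈ Finset.range L, f (m + r) := by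
    refine finsum_eq_sum_of_support_subset _ fun r hr => ?_
    by_contra h
    exact hr (hf _ (by simp at h; omega))
  rw [h1, h2, Finset.sum_range_add, Finset.sum_range]

/-- The base-`q` digit with index `j` that the digital method produces from the `q`-adic integer `x`
in coordinate `i`. The digits form one particular expansion of the coordinate; it may end in digits
`q - 1` throughout. -/
noncomputable def outputDigit {p e s : ℕ} [Fact p.Prime] {R : Type*} [CommRing R]
    (ψ : ℕ → Fin (p ^ e) ≃ R) (lam : Fin s → ℕ → R ≃ Fin (p ^ e)) (C : Fin s → Matrix ℕ ℕ R)
    (x : ℤ_[p]) (i : Fin s) (j : ℕ) : Fin (p ^ e) :=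
  lam i j (∑ᶠ r : ℕ, C i j r * ψ r (qadicDigit e x r))

theorem digitalSequence_eq_ofDigits {p e s : ℕ} [Fact p.Prime] {R : Type*} [CommRing R]
    (ψ : ℕ → Fin (p ^ e) ≃ R) (lam : Fin s → ℕ → R ≃ Fin (p ^ e)) (C : Fin s → Matrix ℕ ℕ R)
    (S : ℕ → ℤ_[p]) :
    digitalSequence ψ lam C S = fun n i => Real.ofDigits (outputDigit ψ lam C (S n) i) := by
  funext n i
  simp only [digitalSequence, digitalPoint, Real.ofDigits, Real.ofDigitsTerm, outputDigit,
    div_eq_mul_inv]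

/-- Among the `q ^ m` elements `l + q ^ m * γ`, `0 ≤ l < q ^ m`, where `m = d₁ + ⋯ + d_s + t`,
exactly `q ^ t` produce prescribed digits in the first `d_i` places of each coordinate `i`: the
digits of `γ` only shift the right-hand side of a linear system for the digits of `l`. -/
theorem card_block_outputDigit {p : ℕ} [Fact p.Prime] {e : ℕ} {F : Type*} [Field F] [Fintype F]
    (hF : Fintype.card F = p ^ e) {s : ℕ}
    (ψ : ℕ → Fin (p ^ e) ≃ F) (lam : Fin s → ℕ → F ≃ Fin (p ^ e))
    (C : Fin s → Matrix ℕ ℕ F) (hC : FiniteRow C)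
    (T : ℕ → ℕ) (hT : HasQuality C T) (t : ℕ) (hTt : ∀ m, T m ≤ t) (d : Fin s → ℕ)
    (g : Fin s → ℕ → Fin (p ^ e)) (γ : ℤ_[p]) :
    ((Finset.range ((p ^ e) ^ (∑ i, d i + t))).filter fun l : ℕ => ∀ i, ∀ j < d i,
      outputDigit ψ lam C ((l : ℤ_[p]) + (p : ℤ_[p]) ^ (e * (∑ i, d i + t)) * γ) i j = g i j).card =
      (p ^ e) ^ t := by
  classical
  set m := ∑ i, d i + t with hm
  set M : Matrix (Σ i : Fin s, Fin (d i)) (Fin m) F :=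
    Matrix.of fun (k : Σ i : Fin s, Fin (d i)) (r : Fin m) => C k.1 k.2 r with hM
  have hcard : Fintype.card (Σ i : Fin s, Fin (d i)) = ∑ i, d i := by simp
  have hrank : M.rank = Fintype.card (Σ i : Fin s, Fin (d i)) := by
    rw [hcard]; exact hT.rank_eq hTt d
  set v : (Σ i : Fin s, Fin (d i)) → F := fun k => (lam k.1 k.2).symm (g k.1 k.2) -
    ∑ᶠ r, C k.1 k.2 (m + r) * ψ (m + r) (qadicDigit e γ r) with hv
  have hsys : ∀ l < (p ^ e) ^ m, ∀ w : Fin m → F,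
      (∀ r : Fin m, w r = ψ r (qadicDigit e ((l : ℤ_[p]) + (p : ℤ_[p]) ^ (e * m) * γ) r)) →
      ((∀ i, ∀ j < d i,
        outputDigit ψ lam C ((l : ℤ_[p]) + (p : ℤ_[p]) ^ (e * m) * γ) i j = g i j) ↔
        M.mulVec w = v) := by
    intro l hl w hw
    have key : ∀ k : Σ i : Fin s, Fin (d i),
        outputDigit ψ lam C ((l : ℤ_[p]) + (p : ℤ_[p]) ^ (e * m) * γ) k.1 k.2 = g k.1 k.2 ↔
          M.mulVec w k = v k := by
      intro k
      obtain ⟨L, hL⟩ := hC k.1 k.2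
      rw [outputDigit, ← Equiv.eq_symm_apply,
        finsum_eq_sum_add_finsum_shift (L := L) (fun r hr => by rw [hL r hr, zero_mul]) m, hv,
        ← eq_sub_iff_add_eq]
      simp only [qadicDigit_of_ge e hl γ (Nat.le_add_right m _), Nat.add_sub_cancel_left,
        Matrix.mulVec, dotProduct, hM, Matrix.of_apply, hw]
    rw [funext_iff]
    constructor
    · exact fun h k => (key k).1 (h k.1 k.2 k.2.isLt)
    · exact fun h i j hj => (key ⟨i, ⟨j, hj⟩⟩).2 (h _)
  have hbij : ((Finset.range ((p ^ e) ^ m)).filter fun l : ℕ => ∀ i, ∀ j < d i,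
      outputDigit ψ lam C ((l : ℤ_[p]) + (p : ℤ_[p]) ^ (e * m) * γ) i j = g i j).card =
      (Finset.univ.filter fun w : Fin m → F => M.mulVec w = v).card := by
    -- The block is parametrised by the first `m` digits, hence by `F ^ m` through the `ψ r`.
    set E : (Fin m → F) ≃ Fin ((p ^ e) ^ m) :=
      (Equiv.piCongrRight fun r : Fin m => (ψ r).symm).trans finFunctionFinEquiv with hE
    have hw : ∀ (w : Fin m → F) (r : Fin m), w r =
        ψ r (qadicDigit e (((E w : ℕ) : ℤ_[p]) + (p : ℤ_[p]) ^ (e * m) * γ) r) := by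
      intro w r
      rw [← Equiv.symm_apply_eq]
      ext
      rw [qadicDigit_of_lt e _ γ r.isLt]
      have h := congrArg Fin.val (congrFun (finFunctionFinEquiv.symm_apply_apply
        (fun r : Fin m => (ψ r).symm (w r))) r)
      exact h.symm
    symm
    refine Finset.card_bij (fun w _ => (E w : ℕ)) ?_ ?_ ?_
    · intro w hmem
      rw [Finset.mem_filter] at hmem ⊢
      exact ⟨Finset.mem_range.2 (E w).isLt, (hsys _ (E w).isLt w (hw w)).2 hmem.2⟩
    · intro w _ w' _ h
      exact E.injective (Fin.ext h)
    · intro l hl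
      rw [Finset.mem_filter, Finset.mem_range] at hl
      have hEl : E (E.symm ⟨l, hl.1⟩) = ⟨l, hl.1⟩ := E.apply_symm_apply _
      refine ⟨E.symm ⟨l, hl.1⟩, Finset.mem_filter.2 ⟨Finset.mem_univ _, ?_⟩, by rw [hEl]⟩
      refine (hsys l hl.1 _ ?_).1 hl.2
      intro r
      have := hw (E.symm ⟨l, hl.1⟩) r
      rwa [hEl] at this
  rw [hbij]
  have h := card_mulVec_eq M hrank v
  have hpow : (p ^ e) ^ m = (p ^ e) ^ (∑ i, d i) * (p ^ e) ^ t := by rw [hm, pow_add]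
  rw [hcard, hF, Fintype.card_fin, hpow] at h
  exact Nat.eq_of_mul_eq_mul_left (pow_pos (pow_pos (Fact.out : p.Prime).pos e) _) h

/-! ### Counting error of elementary intervals -/

/-- If every block `{h * b, …, h * b + b - 1}` contains exactly `a` elements with property `P`,
then the number of such elements below `M` differs from `a * M / b` by at most `a`. -/
theorem abs_count_sub_le_of_blocks {a b : ℕ} (hb : 0 < b) {P : ℕ → Prop} [DecidablePred P]
    (hP : ∀ h, Nat.count (fun l => P (h * b + l)) b = a) (M : ℕ) :
    |(Nat.count P M : ℝ) - a * (M / b)| ≤ a := by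
  have hblock : ∀ h, Nat.count P (h * b) = h * a := by
    intro h
    induction h with
    | zero => simp
    | succ h ih => rw [Nat.add_mul, one_mul, Nat.count_add, ih, hP, Nat.add_mul, one_mul]
  have hlo : (M / b) * a ≤ Nat.count P M := by
    rw [← hblock]
    exact Nat.count_monotone P (Nat.div_mul_le_self M b)
  have hhi : Nat.count P M ≤ (M / b + 1) * a := by
    rw [← hblock]
    refine Nat.count_monotone P ?_
    rw [Nat.add_mul, one_mul]
    exact (Nat.lt_div_mul_add hb).le
  have hlo' : ((M / b : ℕ) : ℝ) * a ≤ Nat.count P M := by exact_mod_cast hlo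
  have hhi' : (Nat.count P M : ℝ) ≤ ((M / b : ℕ) + 1) * a := by exact_mod_cast hhi
  have hfl : ((M / b : ℕ) : ℝ) ≤ M / b := Nat.cast_div_le
  have hfl' : (M : ℝ) / b ≤ (M / b : ℕ) + 1 := by
    rw [div_le_iff₀ (by exact_mod_cast hb)]
    have : M ≤ (M / b + 1) * b := by
      rw [Nat.add_mul, one_mul]
      exact (Nat.lt_div_mul_add hb).le
    exact_mod_cast this
  have ha : (0 : ℝ) ≤ a := Nat.cast_nonneg a
  have h1 := mul_le_mul_of_nonneg_right hfl ha
  have h2 := mul_le_mul_of_nonneg_right hfl' ha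
  rw [abs_le]
  constructor <;> linarith

/-- Every elementary interval has counting error at most `2 * q ^ t`, whatever its order: `N`
consecutive integers form the difference of two initial segments of a sequence of blocks. -/
theorem abs_card_elementary_sub_le {p : ℕ} [Fact p.Prime] {e : ℕ} {F : Type*} [Field F] [Fintype F]
    (hF : Fintype.card F = p ^ e) {s : ℕ}
    (ψ : ℕ → Fin (p ^ e) ≃ F) (lam : Fin s → ℕ → F ≃ Fin (p ^ e))
    (C : Fin s → Matrix ℕ ℕ F) (hC : FiniteRow C)
    (T : ℕ → ℕ) (hT : HasQuality C T) (t : ℕ) (hTt : ∀ m, T m ≤ t) (α : ℤ_[p]) (N : ℕ)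
    (d c : Fin s → ℕ) (hc : ∀ i, c i < (p ^ e) ^ d i) :
    |(((Finset.range N).filter fun n : ℕ =>
        ∀ i, digitPrefix (outputDigit ψ lam C ((n : ℤ_[p]) + α) i) (d i) = c i).card : ℝ) -
      N * ∏ i, 1 / ((p ^ e : ℕ) : ℝ) ^ d i| ≤ 2 * ((p ^ e : ℕ) : ℝ) ^ t := by
  classical
  have hq : 0 < p ^ e := pow_pos (Fact.out : p.Prime).pos e
  choose g hg using fun i => exists_digitPrefix_eq_iff hq (hc i)
  simp_rw [hg]
  set m := ∑ i, d i + t with hm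
  -- With `α = a + q ^ m β`, the numbers `n + α` for `n < N` are `n' + q ^ m β` for
  -- `a ≤ n' < a + N`, and the blocks are aligned with the multiples of `q ^ m` in `n'`.
  obtain ⟨β, hβ⟩ := Ideal.mem_span_singleton.1 (PadicInt.appr_spec (e * m) α)
  set a := PadicInt.appr α (e * m) with ha
  set P : ℕ → Prop := fun n => ∀ i, ∀ j < d i,
    outputDigit ψ lam C ((n : ℤ_[p]) + (p : ℤ_[p]) ^ (e * m) * β) i j = g i j with hP
  have hblock : ∀ h, Nat.count (fun l => P (h * (p ^ e) ^ m + l)) ((p ^ e) ^ m) = (p ^ e) ^ t := by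
    intro h
    rw [Nat.count_eq_card_filter_range,
      ← card_block_outputDigit hF ψ lam C hC T hT t hTt d g ((h : ℤ_[p]) + β)]
    congr 1
    refine Finset.filter_congr fun l _ => ?_
    have : ((h * (p ^ e) ^ m + l : ℕ) : ℤ_[p]) + (p : ℤ_[p]) ^ (e * m) * β =
        (l : ℤ_[p]) + (p : ℤ_[p]) ^ (e * m) * ((h : ℤ_[p]) + β) := by
      push_cast
      rw [← pow_mul]
      ring
    simp only [hP, this]
    exact Iff.rfl
  have hshift : ((Finset.range N).filter fun n : ℕ => ∀ i, ∀ j < d i,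
      outputDigit ψ lam C ((n : ℤ_[p]) + α) i j = g i j).card = Nat.count (fun n => P (a + n)) N := by
    rw [Nat.count_eq_card_filter_range]
    congr 1
    refine Finset.filter_congr fun n _ => ?_
    have : ((a + n : ℕ) : ℤ_[p]) + (p : ℤ_[p]) ^ (e * m) * β = (n : ℤ_[p]) + α := by
      push_cast
      rw [← hβ]
      ring
    simp only [hP, this]
  have hadd : (Nat.count P (a + N) : ℝ) =
      Nat.count P a + Nat.count (fun n => P (a + n)) N := by exact_mod_cast Nat.count_add P a N
  have hqm : 0 < (p ^ e) ^ m := pow_pos hq m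
  have h1 := abs_count_sub_le_of_blocks (P := P) hqm hblock (a + N)
  have h2 := abs_count_sub_le_of_blocks (P := P) hqm hblock a
  have hvol : (N : ℝ) * ∏ i, 1 / ((p ^ e : ℕ) : ℝ) ^ d i =
      (((p ^ e) ^ t : ℕ) : ℝ) * (((a + N : ℕ) : ℝ) / ((p ^ e) ^ m : ℕ)) -
        (((p ^ e) ^ t : ℕ) : ℝ) * ((a : ℝ) / ((p ^ e) ^ m : ℕ)) := by
    have hq' : ((p ^ e : ℕ) : ℝ) ≠ 0 := by exact_mod_cast hq.ne'
    rw [Finset.prod_div_distrib, Finset.prod_const_one, Finset.prod_pow_eq_pow_sum, hm,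
      Nat.cast_pow (p ^ e) t, Nat.cast_pow (p ^ e) (_ + t), pow_add, Nat.cast_add]
    generalize ((p ^ e : ℕ) : ℝ) = Q at hq'
    field_simp
    ring
  rw [hshift, hvol]
  rw [Nat.cast_pow (p ^ e) t, abs_le] at h1 h2
  rw [Nat.cast_pow (p ^ e) t, abs_le]
  constructor
  · linarith [h1.1, h2.2]
  · linarith [h1.2, h2.1]

/-! ### The discrepancy bound -/

/-- The choice `k = ⌊log_q N⌋ + 1` makes the grid of mesh `q ^ (-k)` finer than `1 / N`, while the
number of elementary intervals per coordinate stays of order `log N`. -/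
theorem exists_mul_starDiscrepancy_le_log {b s : ℕ} (hb : 2 ≤ b) {y : ℕ → Fin s → ℕ → Fin b} {B : ℝ}
    (hB : 0 ≤ B)
    (hE : ∀ (N : ℕ) (d c : Fin s → ℕ), (∀ i, c i < b ^ d i) →
      |(((Finset.range N).filter fun n => ∀ i, digitPrefix (y n i) (d i) = c i).card : ℝ) -
        N * ∏ i, 1 / (b : ℝ) ^ d i| ≤ B) :
    ∃ c : ℝ, 0 < c ∧ ∀ N : ℕ, 2 ≤ N →
      N * starDiscrepancy (fun n i => Real.ofDigits (y n i)) N ≤ c * Real.log N ^ s := by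
  have hl2 : 0 < Real.log 2 := Real.log_pos one_lt_two
  have hb2 : (2 : ℝ) ≤ b := by exact_mod_cast hb
  refine ⟨B * ((1 + 2 * b) / Real.log 2) ^ s + (2 * s + 1) * (1 / Real.log 2) ^ s,
    by positivity, fun N hN => ?_⟩
  have hN2 : (2 : ℝ) ≤ N := by exact_mod_cast hN
  set L := Real.log N with hL
  have hL2 : Real.log 2 ≤ L := Real.log_le_log two_pos hN2
  have h1L : 1 ≤ L / Real.log 2 := (one_le_div hl2).2 hL2
  set k := Nat.log b N + 1 with hk
  have hkL : (k : ℝ) ≤ 2 * (L / Real.log 2) := by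
    have h1 : (Nat.log b N : ℝ) ≤ L / Real.log b := Real.natLog_le_logb N b
    have h2 : L / Real.log b ≤ L / Real.log 2 :=
      div_le_div_of_nonneg_left (hl2.le.trans hL2) hl2 (Real.log_le_log two_pos hb2)
    rw [hk]
    push_cast
    linarith
  have hNk : (N : ℝ) / b ^ k ≤ 1 := by
    rw [div_le_one (by positivity)]
    exact_mod_cast (Nat.lt_pow_succ_log_self hb N).le
  have hbase : 1 + (k : ℝ) * b ≤ (1 + 2 * b) / Real.log 2 * L := by
    have : (k : ℝ) * b ≤ 2 * (L / Real.log 2) * b := by gcongr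
    calc 1 + (k : ℝ) * b ≤ L / Real.log 2 + 2 * (L / Real.log 2) * b := add_le_add h1L this
      _ = _ := by ring
  calc N * starDiscrepancy (fun n i => Real.ofDigits (y n i)) N
      ≤ B * (1 + k * b) ^ s + 2 * s * (N / b ^ k) :=
        mul_starDiscrepancy_le (by omega) (by omega) hB (hE N) k
    _ ≤ B * ((1 + 2 * b) / Real.log 2 * L) ^ s + (2 * s + 1) * 1 := by
        gcongr
        linarith
    _ ≤ B * ((1 + 2 * b) / Real.log 2 * L) ^ s + (2 * s + 1) * (L / Real.log 2) ^ s := by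
        gcongr
        exact one_le_pow₀ h1L
    _ = _ := by rw [mul_pow, div_pow L, one_div, inv_pow]; ring

theorem corollary2 {p : ℕ} [Fact p.Prime] {e : ℕ} {F : Type*} [Field F] [Fintype F]
    (hF : Fintype.card F = p ^ e) {s : ℕ} (hs : 1 ≤ s)
    (ψ : ℕ → Fin (p ^ e) ≃ F) (lam : Fin s → ℕ → F ≃ Fin (p ^ e))
    (C : Fin s → Matrix ℕ ℕ F) (hC : FiniteRow C)
    (T : ℕ → ℕ) (hT : HasQuality C T) (t : ℕ) (hTt : ∀ m, T m ≤ t) (α : ℤ_[p]) :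
    IsLowDiscrepancy (digitalSequence ψ lam C fun n => (n : ℤ_[p]) + α) ∧
      (fun N : ℕ => (N : ℝ) *
          starDiscrepancy (digitalSequence ψ lam C fun n => (n : ℤ_[p]) + α) N)
        =O[atTop] fun N : ℕ => Real.log N ^ s := by
  have hq : 2 ≤ p ^ e := hF ▸ Fintype.one_lt_card
  obtain ⟨c, hc, hbound⟩ := exists_mul_starDiscrepancy_le_log hq
    (y := fun n => outputDigit ψ lam C ((n : ℤ_[p]) + α)) (by positivity)
    (abs_card_elementary_sub_le hF ψ lam C hC T hT t hTt α)
  rw [digitalSequence_eq_ofDigits]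
  refine ⟨⟨c, hc, 0, fun N hN => ?_⟩, ?_⟩
  · rw [zero_mul, add_zero]
    exact hbound N hN
  · refine IsBigO.of_bound c ?_
    filter_upwards [eventually_ge_atTop 2] with N hN
    have h := starDiscrepancy_nonneg
      (fun n i => Real.ofDigits (outputDigit ψ lam C ((n : ℤ_[p]) + α) i)) N
    rw [Real.norm_of_nonneg (by positivity), Real.norm_of_nonneg]
    · exact hbound N hN
    · exact pow_nonneg (Real.log_natCast_nonneg N) s
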